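/- Let $K$ be a field (of any characteristic) and let $n\ge 3$. Let $X=(x_{ij})$ and $Y=(y_{ij})$ be $n\times n$ matrices whose $2n^2$ entries are independent indeterminates, let $R=K[x_{ij},y_{ij} : 1\le i,j\le n]$, and let $C=XY-YX=(c_{ij})$. Let $\mathcal{I}\subset R$ be the ideal generated by all diagonal entries $c_{ii}$ and all anti-diagonal entries $c_{i,\,n+1-i}$, $1\le i\le n$. Then $\mathcal{I}$ is generated by a regular sequence in $R$, that is, $R/\mathcal{I}$ is a complete intersection. The Krull dimension of $R/\mathcal{I}$ is $2n^2-2n+2$ if $n$ is odd and $2n^2-2n+1$ if $n$ is even. -/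

import Mathlib

noncomputable section

namespace CommutatorMatrix

/-- The polynomial ring `R = K[X, Y]` in the `2 n ^ 2` entries of two generic `n × n` matrices:
the left summand indexes the `x_{ij}`, the right summand the `y_{ij}`. -/
abbrev PolyRing (K : Type*) [Field K] (n : ℕ) : Type _ :=
  MvPolynomial ((Fin n × Fin n) ⊕ (Fin n × Fin n)) K

/-- The generic matrix `X = (x_{ij})`. -/
def genericX (K : Type*) [Field K] (n : ℕ) : Matrix (Fin n) (Fin n) (PolyRing K n) :=
  Matrix.of fun i j => MvPolynomial.X (Sum.inl (i, j))

/-- The generic matrix `Y = (y_{ij})`. -/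
def genericY (K : Type*) [Field K] (n : ℕ) : Matrix (Fin n) (Fin n) (PolyRing K n) :=
  Matrix.of fun i j => MvPolynomial.X (Sum.inr (i, j))

/-- The commutator matrix `C = X Y - Y X`. -/
def commMatrix (K : Type*) [Field K] (n : ℕ) : Matrix (Fin n) (Fin n) (PolyRing K n) :=
  genericX K n * genericY K n - genericY K n * genericX K n

/-- The ideal generated by the diagonal entries of `C`. -/
def diagIdeal (K : Type*) [Field K] (n : ℕ) : Ideal (PolyRing K n) :=
  Ideal.span (Set.range fun i : Fin n => commMatrix K n i i)

/-- The ideal generated by the anti-diagonal entries of `C`. With indices starting at `0`,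
`Fin.rev i` is `n - 1 - i`. -/
def antidiagIdeal (K : Type*) [Field K] (n : ℕ) : Ideal (PolyRing K n) :=
  Ideal.span (Set.range fun i : Fin n => commMatrix K n i i.rev)

/-- The ideal generated by the diagonal and the anti-diagonal entries of `C`. -/
def diagAntidiagIdeal (K : Type*) [Field K] (n : ℕ) : Ideal (PolyRing K n) :=
  diagIdeal K n ⊔ antidiagIdeal K n

end CommutatorMatrix

end

/-!
If the leading monomials of polynomials over a field are pairwise coprime, then the polynomials are
a Gröbner basis of the ideal they generate and, in any order, a regular sequence. As every maximal
ideal of a polynomial ring over a field has full height, each member of the sequence lowers the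
Krull dimension by exactly one.

Since the trace of `C` vanishes, one diagonal entry `c_{pp}` is a redundant generator. The others
are given pairwise coprime leading monomials `x_{ik} y_{kj}` by a monomial order that compares
weights first. For an anti-diagonal entry `(i, j)` off the diagonal one takes `k = max i j`. For
`(i, i)` one takes `k` to be the parent of `i` in a tree with root `p`: the monomial `x_{ik} y_{ki}`
occurs only in `c_{ii}` and in `c_{kk}`, and weights that increase towards the root let it lead
the former but not the latter. The two kinds of leading monomials are coprime if no tree edge joins
`i` to `n - 1 - i`, which can be arranged as `n ≥ 3`.

The anti-diagonal matters only as the graph of an involution `ρ`, and the parity of `n` only through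
the number of fixed points of `ρ`.
-/

open MvPolynomial RingTheory.Sequence

section Groebner

variable {σ R : Type*} [CommRing R] {m : MonomialOrder σ}

/-- A set `S` of polynomials with invertible leading coefficients is a Gröbner basis, with respect
to the monomial order `m`, of the ideal it spans. Divisibility of leading monomials is expressed as
`≤` on exponents. -/
structure IsGroebnerBasis (m : MonomialOrder σ) (S : Set (MvPolynomial σ R)) : Prop where
  isUnit_leadingCoeff : ∀ f ∈ S, IsUnit (m.leadingCoeff f)
  exists_degree_le : ∀ g ∈ Ideal.span S, g ≠ 0 → ∃ f ∈ S, m.degree f ≤ m.degree g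

theorem le_of_le_add_of_disjoint {a b c : σ →₀ ℕ} (h : a ≤ b + c) (hd : Disjoint a c) :
    a ≤ b := by
  intro x
  have hx : a x ≤ b x + c x := h x
  have hmin : min (a x) (c x) = 0 := DFunLike.congr_fun hd.eq_bot x
  omega

theorem exists_sub_mem_span_of_isUnit_leadingCoeff {S : Set (MvPolynomial σ R)}
    (hS : ∀ f ∈ S, IsUnit (m.leadingCoeff f)) (h : MvPolynomial σ R) :
    ∃ r, h - r ∈ Ideal.span S ∧ (r ≠ 0 → ∀ f ∈ S, ¬ m.degree f ≤ m.degree r) := by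
  obtain ⟨q, r, hqr, -, hr⟩ := m.div_set hS h
  refine ⟨r, ?_, fun hr0 => hr _ (m.degree_mem_support hr0)⟩
  rw [hqr, add_sub_cancel_right, Finsupp.linearCombination_apply]
  exact Submodule.sum_mem _ fun f _ => Ideal.mul_mem_left _ _ (Ideal.subset_span f.2)

theorem not_degree_le_degree_mul {S : Set (MvPolynomial σ R)} {f r : MvPolynomial σ R} (hr0 : r ≠ 0)
    (hr : ∀ g ∈ S, ¬ m.degree g ≤ m.degree r) (hf : IsUnit (m.leadingCoeff f))
    (hd : ∀ g ∈ S, Disjoint (m.degree g) (m.degree f)) :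
    ∀ g ∈ S, ¬ m.degree g ≤ m.degree (r * f) := by
  intro g hg hle
  rw [m.degree_mul_of_isRegular_right hr0 hf.isRegular] at hle
  exact hr g hg (le_of_le_add_of_disjoint hle (hd g hg))

namespace IsGroebnerBasis

theorem empty (m : MonomialOrder σ) : IsGroebnerBasis m (∅ : Set (MvPolynomial σ R)) where
  isUnit_leadingCoeff := by simp
  exists_degree_le := by simp

variable {S : Set (MvPolynomial σ R)} {f : MvPolynomial σ R}

theorem mem_span_of_mul_mem_span (hS : IsGroebnerBasis m S) (hf : IsUnit (m.leadingCoeff f))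
    (hd : ∀ g ∈ S, Disjoint (m.degree g) (m.degree f)) {h : MvPolynomial σ R}
    (hmem : h * f ∈ Ideal.span S) : h ∈ Ideal.span S := by
  obtain ⟨r, hhr, hr⟩ := exists_sub_mem_span_of_isUnit_leadingCoeff hS.isUnit_leadingCoeff h
  suffices hr0 : r = 0 by simpa [hr0] using hhr
  by_contra hr0
  have hrf : r * f ∈ Ideal.span S := by
    have := sub_mem hmem (Ideal.mul_mem_right f _ hhr)
    rwa [← sub_mul, sub_sub_cancel] at this
  have hrf0 : r * f ≠ 0 := fun h0 => hr0 ((m.mem_nonZeroDivisors_of_leadingCoeff_mem_nonZeroDivisors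
    hf.mem_nonZeroDivisors).2 r h0)
  obtain ⟨g, hg, hle⟩ := hS.exists_degree_le _ hrf hrf0
  exact not_degree_le_degree_mul hr0 (hr hr0) hf hd g hg hle

/-- Subtracting from the coefficient of `f` its normal form modulo `S` prevents the leading terms
of the two summands from cancelling. -/
theorem insert (hS : IsGroebnerBasis m S) (hf : IsUnit (m.leadingCoeff f))
    (hd : ∀ g ∈ S, Disjoint (m.degree g) (m.degree f)) : IsGroebnerBasis m (insert f S) where
  isUnit_leadingCoeff := Set.forall_mem_insert.2 ⟨hf, hS.isUnit_leadingCoeff⟩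
  exists_degree_le p hp hp0 := by
    obtain ⟨h, s, hs, rfl⟩ := Ideal.mem_span_insert.1 hp
    obtain ⟨r, hhr, hr⟩ := exists_sub_mem_span_of_isUnit_leadingCoeff hS.isUnit_leadingCoeff h
    obtain ⟨a, ha, hpa⟩ : ∃ a ∈ Ideal.span S, h * f + s = a + r * f :=
      ⟨(h - r) * f + s, add_mem (Ideal.mul_mem_right _ _ hhr) hs, by ring⟩
    rw [hpa] at hp0 ⊢
    by_cases hr0 : r = 0
    · simp only [hr0, zero_mul, add_zero] at hp0 ⊢
      obtain ⟨g, hg, hle⟩ := hS.exists_degree_le a ha hp0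
      exact ⟨g, Set.mem_insert_of_mem _ hg, hle⟩
    have hf_le : m.degree f ≤ m.degree (r * f) := by
      rw [m.degree_mul_of_isRegular_right hr0 hf.isRegular]
      exact le_add_self
    by_cases ha0 : a = 0
    · exact ⟨f, Set.mem_insert _ _, by rwa [ha0, zero_add]⟩
    obtain ⟨g, hg, hg_le⟩ := hS.exists_degree_le a ha ha0
    have hne : m.degree a ≠ m.degree (r * f) := fun he =>
      not_degree_le_degree_mul hr0 (hr hr0) hf hd g hg (he ▸ hg_le)
    rcases lt_or_gt_of_ne (m.toSyn.injective.ne hne) with hlt | hlt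
    · exact ⟨f, Set.mem_insert _ _, by rwa [m.degree_add_eq_right_of_lt hlt]⟩
    · exact ⟨g, Set.mem_insert_of_mem _ hg, by rwa [m.degree_add_of_lt hlt]⟩

theorem of_pairwise_disjoint_degree {rs : List (MvPolynomial σ R)}
    (hu : ∀ f ∈ rs, IsUnit (m.leadingCoeff f))
    (hd : rs.Pairwise fun f g => Disjoint (m.degree f) (m.degree g)) :
    IsGroebnerBasis m {f | f ∈ rs} := by
  induction rs with
  | nil => simpa using empty m
  | cons f rs ih =>
    rw [List.pairwise_cons] at hd
    rw [List.forall_mem_cons] at hu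
    have hcons : {g | g ∈ f :: rs} = Insert.insert f {g | g ∈ rs} := by ext; simp
    rw [hcons]
    exact (ih hu.2 hd.2).insert hu.1 fun g hg => (hd.1 g hg).symm

end IsGroebnerBasis

theorem isWeaklyRegular_of_pairwise_disjoint_degree {rs : List (MvPolynomial σ R)}
    (hu : ∀ f ∈ rs, IsUnit (m.leadingCoeff f))
    (hd : rs.Pairwise fun f g => Disjoint (m.degree f) (m.degree g)) :
    IsWeaklyRegular (MvPolynomial σ R) rs := by
  refine ⟨fun i hi => (isSMulRegular_iff_right_eq_zero_of_smul).2 fun x hx => ?_⟩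
  obtain ⟨h, rfl⟩ := Submodule.Quotient.mk_surjective _ x
  rw [← Submodule.Quotient.mk_smul, Submodule.Quotient.mk_eq_zero] at hx
  rw [Submodule.Quotient.mk_eq_zero]
  simp only [smul_eq_mul, Ideal.mul_top] at hx ⊢
  rw [mul_comm] at hx
  have htake : IsGroebnerBasis m {f | f ∈ rs.take i} :=
    .of_pairwise_disjoint_degree (fun f hf => hu f (List.mem_of_mem_take hf))
      (hd.sublist (List.take_sublist i rs))
  refine htake.mem_span_of_mul_mem_span (hu _ (List.getElem_mem hi)) (fun g hg => ?_) hx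
  obtain ⟨j, hj, rfl⟩ := List.mem_take_iff_getElem.1 hg
  exact List.pairwise_iff_getElem.1 hd _ _ _ _ (by omega)

theorem isRegular_of_pairwise_disjoint_degree [Nontrivial R] {rs : List (MvPolynomial σ R)}
    (hu : ∀ f ∈ rs, IsUnit (m.leadingCoeff f)) (h0 : ∀ f ∈ rs, m.degree f ≠ 0)
    (hd : rs.Pairwise fun f g => Disjoint (m.degree f) (m.degree g)) :
    IsRegular (MvPolynomial σ R) rs := by
  refine ⟨isWeaklyRegular_of_pairwise_disjoint_degree hu hd, fun htop => ?_⟩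
  have h1 : (1 : MvPolynomial σ R) ∈ Ideal.ofList rs := by
    rw [← Ideal.eq_top_iff_one, htop, smul_eq_mul, Ideal.mul_top]
  obtain ⟨f, hf, hle⟩ :=
    (IsGroebnerBasis.of_pairwise_disjoint_degree hu hd).exists_degree_le 1 h1 one_ne_zero
  rw [m.degree_one] at hle
  exact h0 f hf (nonpos_iff_eq_zero.1 hle)

theorem exists_isRegular_of_pairwise_disjoint_degree [Nontrivial R] {ι : Type*} [Fintype ι]
    {f : ι → MvPolynomial σ R} (hu : ∀ i, IsUnit (m.leadingCoeff (f i)))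
    (h0 : ∀ i, m.degree (f i) ≠ 0)
    (hd : Pairwise fun i j => Disjoint (m.degree (f i)) (m.degree (f j))) :
    ∃ rs : List (MvPolynomial σ R), IsRegular (MvPolynomial σ R) rs ∧
      Ideal.ofList rs = Ideal.span (Set.range f) ∧ rs.length = Fintype.card ι := by
  refine ⟨Finset.univ.toList.map f, isRegular_of_pairwise_disjoint_degree (m := m) ?_ ?_ ?_, ?_,
    by simp⟩
  · simpa using hu
  · simpa using h0
  · rw [List.pairwise_map]
    exact (Finset.nodup_toList _).imp fun hij => hd hij
  · exact congrArg Ideal.span (by ext; simp)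

end Groebner

section Dimension

theorem supportDim_add_length_le_of_isWeaklyRegular {R : Type*} [CommRing R]
    {M : Type*} [AddCommGroup M] [Module R M] [Module.Finite R M]
    {rs : List R} (reg : IsWeaklyRegular M rs) :
    Module.supportDim R (M ⧸ Ideal.ofList rs • (⊤ : Submodule R M)) + rs.length ≤
      Module.supportDim R M := by
  induction rs generalizing M with
  | nil =>
    rw [Ideal.ofList_nil, Submodule.bot_smul]
    simpa using (Module.supportDim_eq_of_equiv (Submodule.quotEquivOfEqBot ⊥ rfl)).le
  | cons x rs ih =>
    rw [isWeaklyRegular_cons_iff] at reg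
    rw [Module.supportDim_eq_of_equiv
      (Submodule.quotOfListConsSMulTopEquivQuotSMulTopInner M x rs)]
    calc _ = Module.supportDim R (QuotSMulTop x M ⧸ Ideal.ofList rs • ⊤) + rs.length + 1 := by
          rw [List.length_cons, Nat.cast_add, Nat.cast_one, ← add_assoc]
      _ ≤ Module.supportDim R (QuotSMulTop x M) + 1 := by grw [ih reg.2]
      _ ≤ Module.supportDim R M := Module.supportDim_quotSMulTop_succ_le_of_notMem_minimalPrimes
          fun _ => reg.1.notMem_of_mem_minimalPrimes

theorem ringKrullDim_quotient_add_length_of_isWeaklyRegular {R : Type*} [CommRing R]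
    [IsNoetherianRing R] {rs : List R} (reg : IsWeaklyRegular R rs) {P : Ideal R} [P.IsPrime]
    (hP : P.height = ringKrullDim R) (hle : Ideal.ofList rs ≤ P) :
    ringKrullDim (R ⧸ Ideal.ofList rs) + rs.length = ringKrullDim R := by
  classical
  apply le_antisymm
  · have hdim := supportDim_add_length_le_of_isWeaklyRegular reg
    have hsmul : Ideal.ofList rs • (⊤ : Ideal R) = Ideal.ofList rs := by simp
    rwa [Module.supportDim_quotient_eq_ringKrullDim, Module.supportDim_self_eq_ringKrullDim,
      ringKrullDim_eq_of_ringEquiv (Ideal.quotEquivOfEq hsmul)] at hdim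
  · have hset : {r | r ∈ rs} = (rs.toFinset : Set R) := by ext; simp
    calc ringKrullDim R = P.height := hP.symm
      _ ≤ ringKrullDim (R ⧸ Ideal.ofList rs) + Set.encard {r | r ∈ rs} :=
          Ideal.height_le_ringKrullDim_quotient_add_encard _ (Ideal.span_le.1 hle)
      _ ≤ ringKrullDim (R ⧸ Ideal.ofList rs) + rs.length := by
          rw [hset, Set.encard_coe_eq_coe_finsetCard]
          gcongr
          exact_mod_cast rs.toFinset_card_le

theorem height_eq_card_of_isMaximal_mvPolynomial (K : Type*) [Field K] (σ : Type*) [Finite σ]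
    (P : Ideal (MvPolynomial σ K)) [hP : P.IsMaximal] : P.height = Nat.card σ := by
  induction σ using Finite.induction_empty_option with
  | of_equiv e ih =>
    have hcomap := ih (P.comap (renameEquiv K e).toRingEquiv)
    rwa [RingEquiv.height_comap, Nat.card_congr e] at hcomap
  | h_empty =>
    have hle := Ideal.height_le_ringKrullDim_of_ne_top hP.ne_top
    simpa using hle
  | @h_option τ _ ih =>
    let e := (optionEquivLeft K τ).toRingEquiv
    have : (P.map e).IsMaximal := Ideal.map_isMaximal_of_equiv e
    have : ((P.map e).comap Polynomial.C).IsMaximal :=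
      Polynomial.isMaximal_comap_C_of_isJacobsonRing _
    have : (P.map e).LiesOver ((P.map e).comap Polynomial.C) := ⟨rfl⟩
    rw [← RingEquiv.height_map e P,
      Polynomial.height_eq_height_add_one ((P.map e).comap Polynomial.C), ih]
    simp

theorem ringKrullDim_mvPolynomial_quotient_add_length_of_isRegular {K σ : Type*} [Field K]
    [Finite σ] {rs : List (MvPolynomial σ K)} (reg : IsRegular (MvPolynomial σ K) rs) :
    ringKrullDim (MvPolynomial σ K ⧸ Ideal.ofList rs) + rs.length = (Nat.card σ : ℕ) := by
  have hne : Ideal.ofList rs ≠ ⊤ := fun htop => reg.top_ne_smul (by simp [htop])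
  obtain ⟨P, hP, hle⟩ := Ideal.exists_le_maximal _ hne
  have hdim : ringKrullDim (MvPolynomial σ K) = (Nat.card σ : ℕ) := by simp
  rw [← hdim]
  refine ringKrullDim_quotient_add_length_of_isWeaklyRegular reg.toIsWeaklyRegular ?_ hle
  rw [hdim, height_eq_card_of_isMaximal_mvPolynomial]
  rfl

end Dimension

section WeightOrder

universe u

variable {σ R : Type*} [CommRing R]

open scoped MonomialOrder

/-- The monomial order that compares weights first and breaks ties by `m`. -/
noncomputable def weightOrder (w : σ → ℕ) (m : MonomialOrder σ) : MonomialOrder σ :=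
  let f : (σ →₀ ℕ) →+ ℕ ×ₗ m.syn :=
    { toFun a := toLex (Finsupp.weight w a, m.toSyn a)
      map_zero' := by rw [map_zero, map_zero]; rfl
      map_add' a b := by rw [map_add, map_add]; rfl }
  have hf : Function.Injective f := fun a b h =>
    m.toSyn.injective (congrArg (fun x => (ofLex x).2) h)
  { syn := AddMonoidHom.mrange f
    addCommMonoidSyn := AddSubmonoid.toAddCommMonoid _
    toSyn :=
      { toEquiv := Equiv.ofBijective f.mrangeRestrict
          ⟨fun _ _ h => hf (congrArg Subtype.val h), f.mrangeRestrict_surjective⟩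
        map_add' a b := Subtype.ext (f.map_add a b) }
    toSyn_monotone a b h := by
      change f a ≤ f b
      refine Prod.Lex.toLex_mono ⟨?_, m.toSyn_monotone h⟩
      obtain ⟨c, rfl⟩ := exists_add_of_le h
      simp }

theorem weightOrder_lt_of_weight_lt {w : σ → ℕ} (m : MonomialOrder σ) {a b : σ →₀ ℕ}
    (h : Finsupp.weight w a < Finsupp.weight w b) : a ≺[weightOrder w m] b :=
  Subtype.coe_lt_coe.1 (Prod.Lex.toLex_lt_toLex.2 (Or.inl h))

theorem nonempty_monomialOrder (σ : Type u) [Finite σ] : Nonempty (MonomialOrder.{u, u} σ) :=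
  let _ : LinearOrder σ := LinearOrder.lift' _ (Finite.equivFin σ).injective
  ⟨.lex⟩

theorem degree_eq_of_sub_monomial_mem_restrictSupport {m : MonomialOrder σ} {f : MvPolynomial σ R}
    {s : σ →₀ ℕ} {c : R} (hc : c ≠ 0)
    (hf : f - monomial s c ∈ restrictSupport R {t | t ≺[m] s}) : m.degree f = s := by
  classical
  have hs : m.degree (monomial s c) = s := by rw [m.degree_monomial, if_neg hc]
  by_cases h0 : f - monomial s c = 0
  · rw [sub_eq_zero.1 h0, hs]
  · have hlt : m.degree (f - monomial s c) ≺[m] m.degree (monomial s c) :=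
      hs.symm ▸ (mem_restrictSupport_iff R).1 hf (m.degree_mem_support h0)
    rw [← add_sub_cancel (monomial s c) f, m.degree_add_of_lt hlt, hs]

end WeightOrder

namespace CommutatorMatrix

section LeadingMonomials

open scoped MonomialOrder

variable {n : ℕ} {K : Type*} [Field K]

/-- The exponent of the monomial `x_a y_b`. -/
noncomputable def pairExponent (a b : Fin n × Fin n) :
    (Fin n × Fin n) ⊕ (Fin n × Fin n) →₀ ℕ :=
  Finsupp.single (.inl a) 1 + Finsupp.single (.inr b) 1

theorem pairExponent_ne_zero (a b : Fin n × Fin n) : pairExponent a b ≠ 0 := by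
  simp [pairExponent]

theorem disjoint_pairExponent {a b a' b' : Fin n × Fin n} (ha : a ≠ a') (hb : b ≠ b') :
    Disjoint (pairExponent a b) (pairExponent a' b') := by
  classical
  rw [Finsupp.disjoint_iff, Finset.disjoint_left]
  rintro (t | t) <;>
    simp only [pairExponent, Finsupp.mem_support_iff, Finsupp.add_apply, Finsupp.single_apply] <;>
    grind

theorem commMatrix_apply (i j : Fin n) :
    commMatrix K n i j = ∑ k, (monomial (pairExponent (i, k) (k, j)) (1 : K) -
      monomial (pairExponent (k, j) (i, k)) 1) := by
  simp only [commMatrix, genericX, genericY, Matrix.sub_apply, Matrix.mul_apply, Matrix.of_apply,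
    ← Finset.sum_sub_distrib, X, monomial_mul, one_mul, pairExponent]
  refine Finset.sum_congr rfl fun k _ => ?_
  rw [add_comm (Finsupp.single (Sum.inr (i, k)) 1)]

/-- The weights for which both `x_{ab}` and `y_{ba}` have weight `v a b`. With this choice the
weights of `x_{ik} y_{kj}` and `x_{kj} y_{ik}` are `v i k + v j k` and `v k i + v k j`. -/
def entryWeight (v : Fin n → Fin n → ℕ) : (Fin n × Fin n) ⊕ (Fin n × Fin n) → ℕ :=
  Sum.elim (fun a => v a.1 a.2) fun a => v a.2 a.1

theorem weight_pairExponent (v : Fin n → Fin n → ℕ) (a b : Fin n × Fin n) :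
    Finsupp.weight (entryWeight v) (pairExponent a b) = v a.1 a.2 + v b.2 b.1 := by
  simp [pairExponent, entryWeight, Finsupp.weight_single]

/-- In a diagonal entry the summand `k = i` vanishes, so it is exempt from the weight bounds. -/
theorem degree_commMatrix {m : MonomialOrder ((Fin n × Fin n) ⊕ (Fin n × Fin n))}
    {v : Fin n → Fin n → ℕ} {i j k₀ : Fin n} (hk₀ : i = j → k₀ ≠ i)
    (hleft : ∀ k ≠ k₀, (i = j → k ≠ i) → v i k + v j k < v i k₀ + v j k₀)
    (hright : ∀ k, (i = j → k ≠ i) → v k i + v k j < v i k₀ + v j k₀) :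
    (weightOrder (entryWeight v) m).degree (commMatrix K n i j) = pairExponent (i, k₀) (k₀, j) := by
  refine degree_eq_of_sub_monomial_mem_restrictSupport (one_ne_zero (α := K)) ?_
  set W := restrictSupport K
    {t | t ≺[weightOrder (entryWeight v) m] pairExponent (i, k₀) (k₀, j)}
  have hW {a b : Fin n × Fin n} (h : v a.1 a.2 + v b.2 b.1 < v i k₀ + v j k₀) :
      monomial (pairExponent a b) (1 : K) ∈ W := by
    refine (monomial_mem_restrictSupport K).2 (.inl (weightOrder_lt_of_weight_lt m ?_))
    simpa only [weight_pairExponent] using h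
  have hx {k : Fin n} (hne : k ≠ k₀) (hk : i = j → k ≠ i) :
      monomial (pairExponent (i, k) (k, j)) (1 : K) ∈ W := hW (hleft k hne hk)
  have hy {k : Fin n} (hk : i = j → k ≠ i) :
      monomial (pairExponent (k, j) (i, k)) (1 : K) ∈ W :=
    hW ((add_comm _ _).trans_lt (hright k hk))
  rw [commMatrix_apply, ← Finset.add_sum_erase _ _ (Finset.mem_univ k₀), add_sub_right_comm,
    sub_sub_cancel_left]
  refine add_mem (neg_mem (hy hk₀)) (Submodule.sum_mem _ fun k hk => ?_)
  by_cases hcancel : i = j ∧ k = i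
  · obtain ⟨rfl, rfl⟩ := hcancel
    rw [sub_self]
    exact zero_mem W
  · rw [not_and] at hcancel
    exact sub_mem (hx (Finset.ne_of_mem_erase hk) hcancel) (hy hcancel)

end LeadingMonomials

section Pivots

variable {n : ℕ} {K : Type*} [Field K] {ρ : Fin n → Fin n} {p e i : Fin n}

/-- The column `k` for which `x_{ik} y_{kj}` is to be the leading monomial of the `(i, j)` entry of
the commutator, where `j ∈ {i, ρ i}`. The edges `{i, pivot ρ p e i i}` form a spanning tree rooted
at `p`, in which `ρ p` hangs below `e` and all other vertices hang directly below `p`. -/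
def pivot (ρ : Fin n → Fin n) (p e i j : Fin n) : Fin n :=
  if i = j then if i = ρ p then e else p else max i j

/-- The weight of `x_{ab}` and `y_{ba}` that makes the pivot terms dominant. -/
def pivotWeight (ρ : Fin n → Fin n) (p e a b : Fin n) : ℕ :=
  if a = b then 6 + a
  else if b = ρ a then if a < b then 1 else 0
  else if b = p then 3
  else if a = ρ p ∧ b = e then 2
  else 0

theorem pivotWeight_self (a : Fin n) : pivotWeight ρ p e a a = 6 + a := by
  simp [pivotWeight]

theorem pivotWeight_apply {a : Fin n} (ha : ρ a ≠ a) :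
    pivotWeight ρ p e a (ρ a) = if a < ρ a then 1 else 0 := by
  simp [pivotWeight, ha.symm]

theorem pivotWeight_le_three {a b : Fin n} (hab : a ≠ b) : pivotWeight ρ p e a b ≤ 3 := by
  grind [pivotWeight]

theorem degree_commMatrix_diag {m : MonomialOrder ((Fin n × Fin n) ⊕ (Fin n × Fin n))}
    (hρ : ρ.Involutive) (hep : e ≠ p) (heρ : e ≠ ρ p) (hi : i ≠ p) :
    (weightOrder (entryWeight (pivotWeight ρ p e)) m).degree (commMatrix K n i i) =
      pairExponent (i, pivot ρ p e i i) (pivot ρ p e i i, i) := by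
  have hiρ : p = ρ i ↔ i = ρ p := by rw [eq_comm, hρ.eq_iff]
  refine degree_commMatrix (fun _ => by grind [pivot]) (fun k hk hki => ?_) fun k hki => ?_
  · specialize hki rfl
    grind [pivot, pivotWeight]
  · specialize hki rfl
    grind [pivot, pivotWeight]

theorem degree_commMatrix_graph {m : MonomialOrder ((Fin n × Fin n) ⊕ (Fin n × Fin n))}
    (hρ : ρ.Involutive) (hi : ρ i ≠ i) :
    (weightOrder (entryWeight (pivotWeight ρ p e)) m).degree (commMatrix K n i (ρ i)) =
      pairExponent (i, pivot ρ p e i (ρ i)) (pivot ρ p e i (ρ i), ρ i) := by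
  have hpivot : pivot ρ p e i (ρ i) = max i (ρ i) := if_neg hi.symm
  have hi_ρi := pivotWeight_apply (p := p) (e := e) hi
  have hρi_i := pivotWeight_apply (ρ := ρ) (p := p) (e := e) (a := ρ i) (by rwa [hρ, ne_comm])
  rw [hρ] at hρi_i
  rw [hpivot]
  refine degree_commMatrix (fun hii => absurd hii.symm hi) (fun k hk _ => ?_) fun k _ => ?_
  · grind [pivotWeight_self, pivotWeight_le_three]
  · grind [pivotWeight_self, pivotWeight_le_three]

end Pivots

section Generators

variable (K : Type*) [Field K] {n : ℕ} {ρ : Fin n → Fin n} {p e : Fin n}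

/-- The ideal generated by the diagonal entries of the commutator and its entries on the graph
of `ρ`. -/
noncomputable def diagGraphIdeal (ρ : Fin n → Fin n) : Ideal (PolyRing K n) :=
  diagIdeal K n ⊔ Ideal.span (Set.range fun i => commMatrix K n i (ρ i))

/-- The positions of a minimal set of generators of `diagGraphIdeal K ρ`: the diagonal without
`(p, p)`, and the part of the graph of `ρ` off the diagonal. -/
def generatorPos (ρ : Fin n → Fin n) (p : Fin n) :
    {i // i ≠ p} ⊕ {i // ρ i ≠ i} → Fin n × Fin n :=
  Sum.elim (fun i => (i, i)) fun i => (i, ρ i)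

theorem commMatrix_diag_mem {I : Ideal (PolyRing K n)} (h : ∀ i ≠ p, commMatrix K n i i ∈ I)
    (i : Fin n) : commMatrix K n i i ∈ I := by
  by_cases hi : i = p
  · have htrace : ∑ i, commMatrix K n i i = 0 := by
      change (commMatrix K n).trace = 0
      rw [commMatrix, Matrix.trace_sub, Matrix.trace_mul_comm, sub_self]
    rw [← Finset.add_sum_erase _ _ (Finset.mem_univ p), ← eq_neg_iff_add_eq_zero] at htrace
    rw [hi, htrace]
    exact neg_mem (Submodule.sum_mem _ fun j hj => h j (Finset.ne_of_mem_erase hj))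
  · exact h i hi

theorem span_range_commMatrix_generatorPos (ρ : Fin n → Fin n) (p : Fin n) :
    Ideal.span (Set.range fun g => commMatrix K n (generatorPos ρ p g).1 (generatorPos ρ p g).2) =
      diagGraphIdeal K ρ := by
  apply le_antisymm
  · rw [Ideal.span_le, Set.range_subset_iff]
    rintro (i | i)
    · exact Ideal.mem_sup_left (Ideal.subset_span ⟨i.1, rfl⟩)
    · exact Ideal.mem_sup_right (Ideal.subset_span ⟨i.1, rfl⟩)
  · have hdiag := commMatrix_diag_mem K (p := p) fun i hi =>
      Ideal.subset_span (Set.mem_range_self (f := fun g =>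
        commMatrix K n (generatorPos ρ p g).1 (generatorPos ρ p g).2) (.inl ⟨i, hi⟩))
    rw [diagGraphIdeal, diagIdeal, sup_le_iff, Ideal.span_le, Ideal.span_le,
      Set.range_subset_iff, Set.range_subset_iff]
    refine ⟨hdiag, fun i => ?_⟩
    by_cases hi : ρ i = i
    · rw [hi]
      exact hdiag i
    · exact Ideal.subset_span ⟨.inr ⟨i, hi⟩, rfl⟩

variable {K}

/-- The index of the `x`-variable in the leading monomial of a generator. -/
def leadX (ρ : Fin n → Fin n) (p e : Fin n) (g : {i // i ≠ p} ⊕ {i // ρ i ≠ i}) : Fin n × Fin n :=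
  ((generatorPos ρ p g).1, pivot ρ p e (generatorPos ρ p g).1 (generatorPos ρ p g).2)

/-- The index of the `y`-variable in the leading monomial of a generator. -/
def leadY (ρ : Fin n → Fin n) (p e : Fin n) (g : {i // i ≠ p} ⊕ {i // ρ i ≠ i}) : Fin n × Fin n :=
  (pivot ρ p e (generatorPos ρ p g).1 (generatorPos ρ p g).2, (generatorPos ρ p g).2)

theorem degree_commMatrix_generatorPos
    {m : MonomialOrder ((Fin n × Fin n) ⊕ (Fin n × Fin n))} (hρ : ρ.Involutive) (hep : e ≠ p)
    (heρ : e ≠ ρ p) (g : {i // i ≠ p} ⊕ {i // ρ i ≠ i}) :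
    (weightOrder (entryWeight (pivotWeight ρ p e)) m).degree
        (commMatrix K n (generatorPos ρ p g).1 (generatorPos ρ p g).2) =
      pairExponent (leadX ρ p e g) (leadY ρ p e g) := by
  rcases g with ⟨i, hi⟩ | ⟨i, hi⟩
  · exact degree_commMatrix_diag hρ hep heρ hi
  · exact degree_commMatrix_graph hρ hi

theorem pivot_diag_ne (hρ : ρ.Involutive) (hep : e ≠ p) (heρ : e ≠ ρ p) {i : Fin n} (hi : i ≠ p) :
    pivot ρ p e i i ≠ i ∧ pivot ρ p e i i ≠ ρ i := by
  have hi_iff : ρ i = p ↔ i = ρ p := hρ.eq_iff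
  grind [pivot]

theorem pivot_diag_ne_pivot_graph (hρ : ρ.Involutive) (hep : e ≠ p) (heρ : e ≠ ρ p) {i j : Fin n}
    (hi : i ≠ p) (hj : ρ j ≠ j) (hij : i = j ∨ i = ρ j) :
    pivot ρ p e i i ≠ pivot ρ p e j (ρ j) := by
  obtain ⟨hne, hne_ρ⟩ := pivot_diag_ne hρ hep heρ hi
  have hgraph : pivot ρ p e j (ρ j) = max j (ρ j) := if_neg hj.symm
  have hmem := max_choice j (ρ j)
  rcases hij with rfl | rfl
  · grind
  · rw [hρ] at hne_ρ
    grind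

theorem leadX_injective (hρ : ρ.Involutive) (hep : e ≠ p) (heρ : e ≠ ρ p) :
    Function.Injective (leadX ρ p e) := by
  have hmixed {i j : Fin n} (hi : i ≠ p) (hj : ρ j ≠ j) :
      leadX ρ p e (.inl ⟨i, hi⟩) ≠ leadX ρ p e (.inr ⟨j, hj⟩) := fun h =>
    pivot_diag_ne_pivot_graph hρ hep heρ hi hj (.inl (Prod.ext_iff.1 h).1) (Prod.ext_iff.1 h).2
  rintro (⟨i, hi⟩ | ⟨i, hi⟩) (⟨j, hj⟩ | ⟨j, hj⟩) h
  · exact congrArg Sum.inl (Subtype.ext (Prod.ext_iff.1 h).1)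
  · exact absurd h (hmixed hi hj)
  · exact absurd h.symm (hmixed hj hi)
  · exact congrArg Sum.inr (Subtype.ext (Prod.ext_iff.1 h).1)

theorem leadY_injective (hρ : ρ.Involutive) (hep : e ≠ p) (heρ : e ≠ ρ p) :
    Function.Injective (leadY ρ p e) := by
  have hmixed {i j : Fin n} (hi : i ≠ p) (hj : ρ j ≠ j) :
      leadY ρ p e (.inl ⟨i, hi⟩) ≠ leadY ρ p e (.inr ⟨j, hj⟩) := fun h =>
    pivot_diag_ne_pivot_graph hρ hep heρ hi hj (.inr (Prod.ext_iff.1 h).2) (Prod.ext_iff.1 h).1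
  rintro (⟨i, hi⟩ | ⟨i, hi⟩) (⟨j, hj⟩ | ⟨j, hj⟩) h
  · exact congrArg Sum.inl (Subtype.ext (Prod.ext_iff.1 h).2)
  · exact absurd h (hmixed hi hj)
  · exact absurd h.symm (hmixed hj hi)
  · exact congrArg Sum.inr (Subtype.ext (hρ.injective (Prod.ext_iff.1 h).2))

variable (K)

theorem exists_isRegular_ofList_eq_diagGraphIdeal (hρ : ρ.Involutive) (hn : 3 ≤ n) :
    ∃ rs : List (PolyRing K n), IsRegular (PolyRing K n) rs ∧
      Ideal.ofList rs = diagGraphIdeal K ρ ∧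
      rs.length + 1 + Fintype.card {i // ρ i = i} = 2 * n := by
  let p : Fin n := ⟨0, by omega⟩
  obtain ⟨e, hep, heρ⟩ := Fin.exists_ne_and_ne_of_two_lt p (ρ p) hn
  obtain ⟨m₀⟩ := nonempty_monomialOrder ((Fin n × Fin n) ⊕ (Fin n × Fin n))
  let m := weightOrder (entryWeight (pivotWeight ρ p e)) m₀
  let c (g) := commMatrix K n (generatorPos ρ p g).1 (generatorPos ρ p g).2
  have hdeg (g) : m.degree (c g) = pairExponent (leadX ρ p e g) (leadY ρ p e g) :=
    degree_commMatrix_generatorPos hρ hep heρ g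
  have hdeg0 (g) : m.degree (c g) ≠ 0 := hdeg g ▸ pairExponent_ne_zero _ _
  have hunit (g) : IsUnit (m.leadingCoeff (c g)) :=
    m.isUnit_leadingCoeff.2 (m.ne_zero_of_degree_ne_zero (hdeg0 g))
  have hdisj : Pairwise fun g h => Disjoint (m.degree (c g)) (m.degree (c h)) := fun g h hgh => by
    simp only [hdeg]
    exact disjoint_pairExponent ((leadX_injective hρ hep heρ).ne hgh)
      ((leadY_injective hρ hep heρ).ne hgh)
  obtain ⟨rs, hreg, hspan, hlength⟩ :=
    exists_isRegular_of_pairwise_disjoint_degree hunit hdeg0 hdisj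
  refine ⟨rs, hreg, hspan.trans (span_range_commMatrix_generatorPos K ρ p), ?_⟩
  have hfix := Fintype.card_subtype_le fun i => ρ i = i
  rw [Fintype.card_fin] at hfix
  rw [hlength, Fintype.card_sum, Fintype.card_subtype_compl, Fintype.card_subtype_compl,
    Fintype.card_subtype_eq, Fintype.card_fin]
  omega

theorem card_fin_rev_eq_self (n : ℕ) : Fintype.card {i : Fin n // i.rev = i} = n % 2 := by
  rcases n.even_or_odd' with ⟨k, hk | hk⟩
  · have hempty : IsEmpty {i : Fin n // i.rev = i} := ⟨fun i => by grind⟩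
    rw [Fintype.card_eq_zero, hk, Nat.mul_mod_right]
  · have hkn : k < n := by omega
    have hunique (i : Fin n) : i.rev = i ↔ i = ⟨k, hkn⟩ := by
      rw [Fin.ext_iff, Fin.eq_mk_iff_val_eq, Fin.val_rev]
      omega
    simp only [hunique, Fintype.card_subtype_eq]
    omega

end Generators

end CommutatorMatrix

open CommutatorMatrix in
theorem mainTheorem4_general (K : Type*) [Field K] {n : ℕ} (hn : 3 ≤ n) {ρ : Fin n → Fin n}
    (hρ : ρ.Involutive) :
    (∃ rs : List (PolyRing K n), IsRegular (PolyRing K n) rs ∧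
      Ideal.ofList rs = diagGraphIdeal K ρ) ∧
    ringKrullDim (PolyRing K n ⧸ diagGraphIdeal K ρ) =
      ((2 * n ^ 2 - 2 * n + 1 + Fintype.card {i // ρ i = i} : ℕ) : WithBot ℕ∞) := by
  obtain ⟨rs, hreg, hideal, hlength⟩ := exists_isRegular_ofList_eq_diagGraphIdeal K hρ hn
  refine ⟨⟨rs, hreg, hideal⟩, ?_⟩
  have hdim := ringKrullDim_mvPolynomial_quotient_add_length_of_isRegular hreg
  have hcard : Nat.card ((Fin n × Fin n) ⊕ (Fin n × Fin n)) =
      2 * n ^ 2 - 2 * n + 1 + Fintype.card {i // ρ i = i} + rs.length := by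
    have hsq : n ≤ n ^ 2 := Nat.le_self_pow two_ne_zero n
    rw [Nat.card_sum, Nat.card_prod, Nat.card_fin, ← sq, ← two_mul]
    omega
  rw [hideal, hcard, Nat.cast_add] at hdim
  exact ENat.WithBot.add_natCast_cancel.1 hdim

theorem mainTheorem4 (K : Type*) [Field K] (n : ℕ) (hn : 3 ≤ n) :
    (∃ rs : List (CommutatorMatrix.PolyRing K n),
      RingTheory.Sequence.IsRegular (CommutatorMatrix.PolyRing K n) rs ∧
        Ideal.ofList rs = CommutatorMatrix.diagAntidiagIdeal K n) ∧
    (Odd n →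
      ringKrullDim (CommutatorMatrix.PolyRing K n ⧸ CommutatorMatrix.diagAntidiagIdeal K n) =
        ((2 * n ^ 2 - 2 * n + 2 : ℕ) : WithBot ℕ∞)) ∧
    (Even n →
      ringKrullDim (CommutatorMatrix.PolyRing K n ⧸ CommutatorMatrix.diagAntidiagIdeal K n) =
        ((2 * n ^ 2 - 2 * n + 1 : ℕ) : WithBot ℕ∞)) := by
  obtain ⟨hreg, hdim⟩ := mainTheorem4_general K hn Fin.rev_involutive
  rw [CommutatorMatrix.card_fin_rev_eq_self] at hdim
  exact ⟨hreg, fun hodd => by rwa [Nat.odd_iff.1 hodd] at hdim,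
    fun heven => by rwa [Nat.even_iff.1 heven] at hdim⟩
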